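/- Consider the intuitionistic predicate language with countably many individual variables, countably many predicate letters of every arity, $\bot,\wedge,\vee,\to,\forall,\exists$ (no function symbols, no equality). Formulas are interpreted in the usual Kripke semantics over partially ordered frames $\langle W,\leqslant\rangle$: each world $w$ has a non-empty domain $D_w$, with $D_u\subseteq D_w$ whenever $u\leqslant w$; an interpretation assigns to each world $w$ and each $n$-ary letter an $n$-ary relation on $D_w$, increasing along $\leqslant$; a formula is true in a model if it is true at every world $w$ under every assignment of elements of $D_w$ to its free variables. Let $\mathbf{QSIL}_e\langle\mathbb N,\leqslant\rangle$ be the set of formulas true in all models based on the Kripke frame $\langle\mathbb N,\leqslant\rangle$ with arbitrary (expanding) domains, and let $\mathbf{QSIL}(\langle\mathbb N,\leqslant\rangle\odot\mathbb N)$ be the set of formulas true in all models based on $\langle\mathbb N,\leqslant\rangle$ in which every world has domain $\mathbb N$. Let $\mathcal L_2$ be the set of formulas that contain no individual variables other than two fixed ones and no predicate letters other than one fixed binary letter and the (infinitely many) unary letters. **Theorem.** Let $L$ be any set of formulas (in particular, any logic) with $\mathbf{QSIL}_e\langle\mathbb N,\leqslant\rangle\subseteq L\subseteq \mathbf{QSIL}(\langle\mathbb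 N,\leqslant\rangle\odot\mathbb N)$. Then $L$ is both $\Sigma^0_1$-hard and $\Pi^0_1$-hard in the language $\mathcal L_2$: for every $A\subseteq\mathbb N$ such that $A$ or its complement is recursively enumerable there is a computable function $f$ from $\mathbb N$ to formulas in $\mathcal L_2$ such that $n\in A\iff f(n)\in L$ for all $n$. Hence $L\cap\mathcal L_2$ is not recursively enumerable. In particular, all this holds for $L=\mathbf{QSIL}_e\langle\mathbb N,\leqslant\rangle$, the logic of $\omega$ as a Kripke frame. -/

import Mathlib

universe u v

/-! ## Syntax of the intuitionistic predicate language -/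

/-- Formulas of the (pure, function-free) intuitionistic predicate language. Individual variables
are natural numbers. `atom k xs` is the atomic formula `P(x₁,…,xₙ)` where `xs = [x₁,…,xₙ]` and
`P` is the `k`-th predicate letter of arity `n = xs.length`; so there are countably many
predicate letters of every arity. -/
inductive IPFormula : Type where
  | bot : IPFormula
  | atom (k : ℕ) (xs : List ℕ) : IPFormula
  | and (φ ψ : IPFormula) : IPFormula
  | or (φ ψ : IPFormula) : IPFormula
  | imp (φ ψ : IPFormula) : IPFormula
  | all (x : ℕ) (φ : IPFormula) : IPFormula
  | ex (x : ℕ) (φ : IPFormula) : IPFormula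

namespace IPFormula

/-- The free variables of a formula. -/
def freeVars : IPFormula → Set ℕ
  | bot => ∅
  | atom _ xs => {x | x ∈ xs}
  | and φ ψ => freeVars φ ∪ freeVars ψ
  | or φ ψ => freeVars φ ∪ freeVars ψ
  | imp φ ψ => freeVars φ ∪ freeVars ψ
  | all x φ => freeVars φ \ {x}
  | ex x φ => freeVars φ \ {x}

/-- The formulas of the language with the two individual variables `0` and `1`, a single binary
predicate letter (the one with index `0`) and all (infinitely many) unary predicate letters; no
other predicate letters are allowed. -/
def InTwoVarFragment : IPFormula → Prop
  | bot => True
  | atom k xs => (xs.length = 1 ∨ (xs.length = 2 ∧ k = 0)) ∧ ∀ x ∈ xs, x < 2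
  | and φ ψ => InTwoVarFragment φ ∧ InTwoVarFragment ψ
  | or φ ψ => InTwoVarFragment φ ∧ InTwoVarFragment ψ
  | imp φ ψ => InTwoVarFragment φ ∧ InTwoVarFragment ψ
  | all x φ => x < 2 ∧ InTwoVarFragment φ
  | ex x φ => x < 2 ∧ InTwoVarFragment φ

/-- The set of all formulas of the two-variable language above. -/
def twoVarFragment : Set IPFormula := {φ | InTwoVarFragment φ}

/-! ### A standard (bijective) Gödel numbering of formulas -/

/-- The Gödel number of a formula. -/
def godelNum : IPFormula → ℕ
  | bot => 0
  | atom k xs => 6 * Nat.pair k (Encodable.encode xs) + 1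
  | and φ ψ => 6 * Nat.pair (godelNum φ) (godelNum ψ) + 1 + 1
  | or φ ψ => 6 * Nat.pair (godelNum φ) (godelNum ψ) + 2 + 1
  | imp φ ψ => 6 * Nat.pair (godelNum φ) (godelNum ψ) + 3 + 1
  | all x φ => 6 * Nat.pair x (godelNum φ) + 4 + 1
  | ex x φ => 6 * Nat.pair x (godelNum φ) + 5 + 1

/-- The formula with a given Gödel number. -/
def ofGodelNum : ℕ → IPFormula
  | 0 => bot
  | n + 1 =>
    have _h1 : (n / 6).unpair.1 < n + 1 :=
      Nat.lt_succ_of_le ((Nat.unpair_left_le _).trans (Nat.div_le_self _ _))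
    have _h2 : (n / 6).unpair.2 < n + 1 :=
      Nat.lt_succ_of_le ((Nat.unpair_right_le _).trans (Nat.div_le_self _ _))
    match n % 6 with
    | 0 => atom (n / 6).unpair.1 (Denumerable.ofNat (List ℕ) (n / 6).unpair.2)
    | 1 => and (ofGodelNum (n / 6).unpair.1) (ofGodelNum (n / 6).unpair.2)
    | 2 => or (ofGodelNum (n / 6).unpair.1) (ofGodelNum (n / 6).unpair.2)
    | 3 => imp (ofGodelNum (n / 6).unpair.1) (ofGodelNum (n / 6).unpair.2)
    | 4 => all (n / 6).unpair.1 (ofGodelNum (n / 6).unpair.2)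
    | _ => ex (n / 6).unpair.1 (ofGodelNum (n / 6).unpair.2)

theorem ofGodelNum_godelNum (φ : IPFormula) : ofGodelNum (godelNum φ) = φ := by
  have hd : ∀ a r : ℕ, r < 6 → (6 * a + r) / 6 = a := fun a r h => by omega
  have hm : ∀ a r : ℕ, r < 6 → (6 * a + r) % 6 = r := fun a r h => by omega
  induction φ with
  | bot => simp [godelNum, ofGodelNum]
  | atom k xs =>
    rw [godelNum, ofGodelNum, Nat.mul_div_cancel_left _ (by norm_num), Nat.mul_mod_right]; simp
  | and φ ψ h1 h2 =>
    rw [godelNum, ofGodelNum, hd _ _ (by norm_num), hm _ _ (by norm_num)]; simp [h1, h2]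
  | or φ ψ h1 h2 =>
    rw [godelNum, ofGodelNum, hd _ _ (by norm_num), hm _ _ (by norm_num)]; simp [h1, h2]
  | imp φ ψ h1 h2 =>
    rw [godelNum, ofGodelNum, hd _ _ (by norm_num), hm _ _ (by norm_num)]; simp [h1, h2]
  | all x φ h =>
    rw [godelNum, ofGodelNum, hd _ _ (by norm_num), hm _ _ (by norm_num)]; simp [h]
  | ex x φ h =>
    rw [godelNum, ofGodelNum, hd _ _ (by norm_num), hm _ _ (by norm_num)]; simp [h]

theorem godelNum_ofGodelNum (n : ℕ) : godelNum (ofGodelNum n) = n := by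
  induction n using Nat.strong_induction_on with
  | _ n ih =>
    cases n with
    | zero => simp [godelNum, ofGodelNum]
    | succ n =>
      have h1 := ih (n / 6).unpair.1
        (Nat.lt_succ_of_le ((Nat.unpair_left_le _).trans (Nat.div_le_self _ _)))
      have h2 := ih (n / 6).unpair.2
        (Nat.lt_succ_of_le ((Nat.unpair_right_le _).trans (Nat.div_le_self _ _)))
      have hlt : n % 6 < 6 := Nat.mod_lt _ (by norm_num)
      have hdm := Nat.div_add_mod n 6
      rw [ofGodelNum]
      rcases h : n % 6 with _ | _ | _ | _ | _ | _ | r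
      · simp only [godelNum, Denumerable.encode_ofNat, Nat.pair_unpair]; omega
      · simp only [godelNum, h1, h2, Nat.pair_unpair]; omega
      · simp only [godelNum, h1, h2, Nat.pair_unpair]; omega
      · simp only [godelNum, h1, h2, Nat.pair_unpair]; omega
      · simp only [godelNum, h2, Nat.pair_unpair]; omega
      · simp only [godelNum, h2, Nat.pair_unpair]; omega
      · omega

/-- Computability of functions into formulas and recursive enumerability of sets of formulas
(`Computable`, `REPred`) refer to this numbering. -/
instance : Denumerable IPFormula :=
  Denumerable.mk' ⟨godelNum, ofGodelNum, ofGodelNum_godelNum, godelNum_ofGodelNum⟩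

end IPFormula

/-! ## Kripke semantics -/

/-- An (expanding domain) augmented frame based on the intuitionistic Kripke frame `⟨W, ≤⟩`, with
individuals from the set `U`. -/
structure AugFrame (W : Type*) [PartialOrder W] (U : Type*) where
  /-- The domain of a world. -/
  dom : W → Set U
  dom_nonempty : ∀ w, (dom w).Nonempty
  dom_mono : ∀ ⦃u w : W⦄, u ≤ w → dom u ⊆ dom w

/-- An interpretation of predicate letters in an augmented frame: `rel w k as` says that the tuple
`as` of length `n` belongs to the `n`-ary relation `I(w, P)` on the domain of `w`, where `P` is
the `k`-th `n`-ary predicate letter. -/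
structure KripkeInterp {W U : Type*} [PartialOrder W] (F : AugFrame W U) where
  rel : W → ℕ → List U → Prop
  rel_dom : ∀ w k as, rel w k as → ∀ a ∈ as, a ∈ F.dom w
  heredity : ∀ ⦃w w' : W⦄, w ≤ w' → ∀ k as, rel w k as → rel w' k as

namespace KripkeInterp

variable {W U : Type*} [PartialOrder W] {F : AugFrame W U}

/-- Truth of a formula at a world under an assignment. -/
def Truth (I : KripkeInterp F) : W → (ℕ → U) → IPFormula → Prop
  | _, _, .bot => False
  | w, g, .atom k xs => I.rel w k (xs.map g)
  | w, g, .and φ ψ => Truth I w g φ ∧ Truth I w g ψ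
  | w, g, .or φ ψ => Truth I w g φ ∨ Truth I w g ψ
  | w, g, .imp φ ψ => ∀ v, w ≤ v → Truth I v g φ → Truth I v g ψ
  | w, g, .all x φ => ∀ v, w ≤ v → ∀ a ∈ F.dom v, Truth I v (Function.update g x a) φ
  | w, g, .ex x φ => ∃ a ∈ F.dom w, Truth I w (Function.update g x a) φ

/-- A formula is true in a model: true at every world under every assignment that maps its free
variables into the domain of that world. -/
def Models (I : KripkeInterp F) (φ : IPFormula) : Prop :=
  ∀ (w : W) (g : ℕ → U), (∀ x ∈ φ.freeVars, g x ∈ F.dom w) → I.Truth w g φ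

end KripkeInterp

/-- The logic of a single augmented frame: all formulas true in every model based on it. -/
def AugFrame.logic {W U : Type*} [PartialOrder W] (F : AugFrame W U) : Set IPFormula :=
  {φ | ∀ I : KripkeInterp F, I.Models φ}

/-- The augmented frame `⟨W, ≤⟩ ⊙ U`, in which every world has the domain `U`. -/
def constAugFrame (W : Type*) [PartialOrder W] (U : Type*) [Nonempty U] : AugFrame W U where
  dom _ := Set.univ
  dom_nonempty _ := Set.univ_nonempty
  dom_mono _ _ _ := subset_rfl

/-- The logic of the Kripke frame `⟨W, ≤⟩`, i.e. of the class of all expanding domain augmented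
frames (with a set of individuals in the universe `u`) based on it. -/
def expLogic (W : Type v) [PartialOrder W] : Set IPFormula :=
  {φ | ∀ (U : Type u) (F : AugFrame W U), φ ∈ F.logic}

/-! ## Hardness -/

/-- `L` is `Σ⁰₁`-hard in the language `S`: every recursively enumerable set of natural numbers is
many-one reducible to `L` by a computable function whose values are formulas of `S`. -/
def SigmaOneHardIn (S L : Set IPFormula) : Prop :=
  ∀ p : ℕ → Prop, REPred p →
    ∃ f : ℕ → IPFormula, Computable f ∧ (∀ n, f n ∈ S) ∧ ∀ n, p n ↔ f n ∈ L

/-- `L` is `Π⁰₁`-hard in the language `S`: every set of natural numbers with a recursively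
enumerable complement is many-one reducible to `L` by a computable function whose values are
formulas of `S`. -/
def PiOneHardIn (S L : Set IPFormula) : Prop :=
  ∀ p : ℕ → Prop, REPred (fun n => ¬ p n) →
    ∃ f : ℕ → IPFormula, Computable f ∧ (∀ n, f n ∈ S) ∧ ∀ n, p n ↔ f n ∈ L

/-!
The proof encodes first-order arithmetic in Kripke models on `⟨ℕ, ≤⟩`. At a fixed world `w`, a unary
letter `P` assigns to each individual `a` a value in `ℕ∞`, the first world from `w` on at which
`P a` is true. Then `Q y → P x` holds at `w` iff the value of `P` at `x` is at most that of `Q` at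
`y`. If moreover a sentence `G` is false at `w`, then `(P x → Q y) → G` entails the strict
comparison `P x < Q y`, and the two are equivalent in the standard model at world `0`. Positive
combinations of such comparisons (`OrderFormula`) are therefore evaluated at `w` classically, with
quantifiers over the domain of `w`. In an expanding frame the intuitionistic truth of such a
combination implies its classical truth (`KripkeInterp.sat_of_truth_toIP`); in the standard model
with domain `ℕ` the converse holds at world `0` (`truth_toIP_of_sat`). Only these two directions are
needed.

The letters are indexed by codes of primitive recursive functions, and the intended value of a code
at an individual is the value of the function. With existential quantifiers over a second variable
one can state the recursion equations of every such function using two variables only, because the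
argument and the value of each function are single numbers and tuples are coded by `Nat.pair`. As
finite values have only finitely many values below them, every individual in a model of these axioms
is a standard number (`IsArithmetic.of_sat`), and every code has its intended values
(`IsArithmetic.value_eq`).

A recursively enumerable set is `{n | ∃ m, c (n, m) = 0}` with `c` primitive recursive. The formula
"the axioms hold, and `χ` holds of `n`, implies `G`" is thus refuted in the standard model when `χ`
is true of `n`, and lies in the logic of all expanding frames otherwise. Taking for `χ` the
statement that `c (n, ·)` has no zero gives `Σ⁰₁`-hardness, and the statement that it has a zero
gives `Π⁰₁`-hardness, for all sets between the two logics at once.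
-/

open Nat.Partrec (Code)

/-! ### Comparisons of birth times -/

/-- Order formulas: positive combinations of comparisons between values `V c x`, where `V` assigns
to every code `c` a function on individuals and `x` is one of two individual variables.
`le c d x y` stands for `V c x ≤ V d y`, and `lt c d x y` for `V c x < V d y`. -/
inductive OrderFormula : Type where
  | le (c d : Code) (x y : Fin 2)
  | lt (c d : Code) (x y : Fin 2)
  | and (φ ψ : OrderFormula)
  | or (φ ψ : OrderFormula)
  | all (x : Fin 2) (φ : OrderFormula)
  | ex (x : Fin 2) (φ : OrderFormula)

namespace OrderFormula

/-- Equality of two values. -/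
def eq (c d : Code) (x y : Fin 2) : OrderFormula := and (le c d x y) (le d c y x)

/-- Classical satisfaction of an order formula, with quantifiers ranging over `D`. -/
def Sat {U α : Type*} [LinearOrder α] (D : Set U) (V : Code → U → α) :
    (ℕ → U) → OrderFormula → Prop
  | g, le c d x y => V c (g x) ≤ V d (g y)
  | g, lt c d x y => V c (g x) < V d (g y)
  | g, and φ ψ => Sat D V g φ ∧ Sat D V g ψ
  | g, or φ ψ => Sat D V g φ ∨ Sat D V g ψ
  | g, all x φ => ∀ a ∈ D, Sat D V (Function.update g x a) φ
  | g, ex x φ => ∃ a ∈ D, Sat D V (Function.update g x a) φ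

@[simp]
theorem sat_eq {U α : Type*} [LinearOrder α] {D : Set U} {V : Code → U → α} {g : ℕ → U}
    {c d : Code} {x y : Fin 2} : Sat D V g (eq c d x y) ↔ V c (g x) = V d (g y) :=
  le_antisymm_iff.symm

/-- The atomic formula whose birth time at `x` is the value of `c` at `x`. -/
def letter (c : Code) (x : ℕ) : IPFormula := .atom (Encodable.encode c) [x]

/-- The sentence `∃ x, Z x`, where `Z` is the letter of the code of the zero function. It plays
the role of falsity: formulas are evaluated at worlds where it is not true. -/
def falsum : IPFormula := .ex 0 (letter .zero 0)

/-- The intuitionistic rendering of an order formula. An implication compares birth times, and a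
strict comparison is the converse implication, negated with `falsum` for falsity. -/
def toIP : OrderFormula → IPFormula
  | le c d x y => .imp (letter d y) (letter c x)
  | lt c d x y => .imp (.imp (letter c x) (letter d y)) falsum
  | and φ ψ => .and φ.toIP ψ.toIP
  | or φ ψ => .or φ.toIP ψ.toIP
  | all x φ => .all x φ.toIP
  | ex x φ => .ex x φ.toIP

theorem falsum_mem : falsum ∈ IPFormula.twoVarFragment := by
  simp [falsum, letter, IPFormula.twoVarFragment, IPFormula.InTwoVarFragment]

theorem toIP_mem (φ : OrderFormula) : φ.toIP ∈ IPFormula.twoVarFragment := by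
  have h := falsum_mem
  change IPFormula.InTwoVarFragment _ at h ⊢
  induction φ with
  | le c d x y => simpa [toIP, letter, IPFormula.InTwoVarFragment] using ⟨y.is_le, x.is_le⟩
  | lt c d x y => simpa [toIP, letter, IPFormula.InTwoVarFragment, h] using ⟨x.is_le, y.is_le⟩
  | and φ ψ h₁ h₂ => exact ⟨h₁, h₂⟩
  | or φ ψ h₁ h₂ => exact ⟨h₁, h₂⟩
  | all x φ h₁ => exact ⟨x.isLt, h₁⟩
  | ex x φ h₁ => exact ⟨x.isLt, h₁⟩

end OrderFormula

open OrderFormula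

namespace KripkeInterp

theorem Truth.mono {W U : Type*} [PartialOrder W] {F : AugFrame W U} {I : KripkeInterp F}
    {φ : IPFormula} : ∀ {w v : W} {g : ℕ → U}, w ≤ v → I.Truth w g φ → I.Truth v g φ := by
  induction φ with
  | bot => exact fun _ h => h
  | atom k xs => exact fun hv h => I.heredity hv _ _ h
  | and φ ψ h₁ h₂ => exact fun hv h => ⟨h₁ hv h.1, h₂ hv h.2⟩
  | or φ ψ h₁ h₂ => exact fun hv h => h.imp (h₁ hv) (h₂ hv)
  | imp φ ψ => exact fun hv h u hu => h u (hv.trans hu)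
  | all x φ => exact fun hv h u hu => h u (hv.trans hu)
  | ex x φ ih => exact fun hv ⟨a, ha, h⟩ => ⟨a, F.dom_mono hv ha, ih hv h⟩

variable {U : Type*} {F : AugFrame ℕ U} (I : KripkeInterp F)

/-- The first world from `w` on at which the letter of `c` holds of `a`, or `⊤` if there is
none. -/
noncomputable def birth (w : ℕ) (c : Code) (a : U) : ℕ∞ :=
  sInf {t | ∃ v : ℕ, t = v ∧ w ≤ v ∧ I.rel v (Encodable.encode c) [a]}

variable {I}

theorem birth_le_iff {w v : ℕ} (hv : w ≤ v) {c : Code} {a : U} :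
    I.birth w c a ≤ v ↔ I.rel v (Encodable.encode c) [a] := by
  refine ⟨fun h => ?_, fun h => sInf_le ⟨v, rfl, hv, h⟩⟩
  have hne : {t : ℕ∞ | ∃ v : ℕ, t = v ∧ w ≤ v ∧ I.rel v (Encodable.encode c) [a]}.Nonempty := by
    by_contra hn
    rw [Set.not_nonempty_iff_eq_empty] at hn
    rw [birth, hn, sInf_empty] at h
    exact absurd h (by simp)
  obtain ⟨u, hu, -, hr⟩ := csInf_mem hne
  rw [birth, hu, Nat.cast_le] at h
  exact I.heredity h _ _ hr

theorem le_birth (w : ℕ) (c : Code) (a : U) : (w : ℕ∞) ≤ I.birth w c a :=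
  le_sInf fun _ ⟨_, ht, hv, _⟩ => ht ▸ Nat.cast_le.2 hv

theorem birth_le_birth_iff {w : ℕ} {c d : Code} {a b : U} :
    I.birth w c a ≤ I.birth w d b ↔
      ∀ v ≥ w, I.rel v (Encodable.encode d) [b] → I.rel v (Encodable.encode c) [a] := by
  constructor
  · intro h v hv
    rw [← birth_le_iff hv, ← birth_le_iff hv]
    exact h.trans
  · intro h
    obtain ht | ht := eq_or_ne (I.birth w d b) ⊤
    · exact ht ▸ le_top
    · obtain ⟨v, hv⟩ := ENat.ne_top_iff_exists.1 ht
      have hw : w ≤ v := Nat.cast_le.1 (hv ▸ le_birth w d b)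
      rw [← hv, birth_le_iff hw]
      exact h v hw ((birth_le_iff hw).1 hv.ge)

/-- The converse may fail in an expanding frame, as the individuals of later worlds are not in the
range of the quantifiers of `Sat (F.dom w)`. -/
theorem sat_of_truth_toIP {w : ℕ} (hG : ∀ g, ¬ I.Truth w g falsum) {φ : OrderFormula} :
    ∀ {g : ℕ → U}, I.Truth w g φ.toIP → Sat (F.dom w) (I.birth w) g φ := by
  induction φ with
  | le c d x y => exact fun h => birth_le_birth_iff.2 h
  | lt c d x y =>
    intro g h
    by_contra hn
    exact hG g (h w le_rfl (birth_le_birth_iff.1 (not_lt.1 hn)))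
  | and φ ψ h₁ h₂ => exact fun h => ⟨h₁ h.1, h₂ h.2⟩
  | or φ ψ h₁ h₂ => exact fun h => h.imp h₁ h₂
  | all x φ ih => exact fun h a ha => ih (h w le_rfl a ha)
  | ex x φ ih => exact fun ⟨a, ha, h⟩ => ⟨a, ha, ih h⟩

end KripkeInterp

/-- The interpretation in `⟨ℕ, ≤⟩ ⊙ ℕ` in which the letter of the code `c` is born at world
`V c a + 1` for the individual `a`, and all letters of other arities are empty. -/
def interpOfValues (V : Code → ℕ → ℕ) : KripkeInterp (constAugFrame ℕ ℕ) where
  rel w k as := ∃ a, as = [a] ∧ V (Denumerable.ofNat Code k) a < w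
  rel_dom _ _ _ _ _ _ := trivial
  heredity := fun _ _ hw _ _ ⟨a, ha, h⟩ => ⟨a, ha, h.trans_le hw⟩

section InterpOfValues

variable {V : Code → ℕ → ℕ}

theorem interpOfValues_truth_letter {w x : ℕ} {g : ℕ → ℕ} {c : Code} :
    (interpOfValues V).Truth w g (letter c x) ↔ V c (g x) < w := by
  simp [letter, KripkeInterp.Truth, interpOfValues]

theorem interpOfValues_truth_falsum (hV : ∀ a, V .zero a = 0) {w : ℕ} {g : ℕ → ℕ} :
    (interpOfValues V).Truth w g falsum ↔ 0 < w := by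
  simp only [falsum, KripkeInterp.Truth, interpOfValues_truth_letter, hV]
  exact ⟨fun ⟨_, _, h⟩ => h, fun h => ⟨0, trivial, h⟩⟩

theorem truth_toIP_of_sat (hV : ∀ a, V .zero a = 0) {φ : OrderFormula} :
    ∀ {g : ℕ → ℕ}, Sat Set.univ V g φ → (interpOfValues V).Truth 0 g φ.toIP := by
  induction φ with
  | le c d x y =>
    intro g h v _ hd
    rw [interpOfValues_truth_letter] at hd ⊢
    exact lt_of_le_of_lt h hd
  | lt c d x y =>
    intro g h v _ hcd
    rw [interpOfValues_truth_falsum hV]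
    by_contra hv
    -- at world `0` the implication compares the values themselves
    have := hcd (V c (g x) + 1) (by omega) (interpOfValues_truth_letter.2 (Nat.lt_succ_self _))
    rw [interpOfValues_truth_letter] at this
    exact absurd h (not_lt.2 (Nat.lt_succ_iff.1 this))
  | and φ ψ h₁ h₂ => exact fun h => ⟨h₁ h.1, h₂ h.2⟩
  | or φ ψ h₁ h₂ => exact fun h => h.imp h₁ h₂
  | all x φ ih => exact fun h v hv a _ => (ih (h a trivial)).mono hv
  | ex x φ ih => exact fun ⟨a, _, h⟩ => ⟨a, trivial, ih h⟩

end InterpOfValues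

/-! ### Primitive recursive functions and their axioms -/

/-- The primitive recursive function denoted by a code, where `rfind'`, which codes without
unbounded search do not contain, is read as the zero function. -/
def Nat.Partrec.Code.value : Code → ℕ → ℕ
  | .zero, _ => 0
  | .succ, n => n + 1
  | .left, n => n.unpair.1
  | .right, n => n.unpair.2
  | .pair f g, n => Nat.pair (f.value n) (g.value n)
  | .comp f g, n => f.value (g.value n)
  | .prec f g, n =>
    Nat.rec (f.value n.unpair.1)
      (fun y ih => g.value (Nat.pair n.unpair.1 (Nat.pair y ih))) n.unpair.2
  | .rfind' _, _ => 0

theorem Nat.Partrec.Code.value_id (n : ℕ) : Code.id.value n = n := by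
  simp [Code.id, Code.value]

theorem Nat.Primrec.exists_code_value {f : ℕ → ℕ} (hf : Nat.Primrec f) :
    ∃ c : Code, c.value = f := by
  induction hf with
  | zero => exact ⟨.zero, rfl⟩
  | succ => exact ⟨.succ, rfl⟩
  | left => exact ⟨.left, rfl⟩
  | right => exact ⟨.right, rfl⟩
  | pair _ _ h₁ h₂ =>
    obtain ⟨c, rfl⟩ := h₁
    obtain ⟨d, rfl⟩ := h₂
    exact ⟨.pair c d, rfl⟩
  | comp _ _ h₁ h₂ =>
    obtain ⟨c, rfl⟩ := h₁
    obtain ⟨d, rfl⟩ := h₂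
    exact ⟨.comp c d, rfl⟩
  | prec _ _ h₁ h₂ =>
    obtain ⟨c, rfl⟩ := h₁
    obtain ⟨d, rfl⟩ := h₂
    exact ⟨.prec c d, rfl⟩

namespace OrderFormula

/-- Zero is constant, attained and minimal. -/
def zeroAx : OrderFormula :=
  and (all 0 (all 1 (le .zero .zero 0 1)))
    (and (ex 0 (eq .id .zero 0 0)) (all 0 (le .zero .id 0 0)))

/-- The value of `succ` is the next value of `id` above that of `id`. -/
def succAx : OrderFormula :=
  and (all 0 (lt .id .succ 0 0))
    (and (all 0 (all 1 (or (le .id .id 1 0) (le .succ .id 0 1))))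
      (all 0 (ex 1 (eq .id .succ 1 0))))

/-- The graph axiom of a composition. -/
def compAx (f g : Code) : OrderFormula :=
  all 0 (ex 1 (and (eq .id g 1 0) (eq (.comp f g) f 0 1)))

/-- The graph axiom of a pairing. -/
def pairAx (f g : Code) : OrderFormula :=
  all 0 (ex 1 (and (eq .id (.pair f g) 1 0) (and (eq .left f 1 0) (eq .right g 1 0))))

/-- The code of the argument at which the step function of the recursion `prec f g` is
evaluated. -/
def stepArg (f g : Code) : Code := .pair .left (.pair .right (.prec f g))

/-- The recursion equations of `prec f g`. -/
def precAx (f g : Code) : OrderFormula :=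
  all 0 (or
    (and (eq .right .zero 0 0) (ex 1 (and (eq .id .left 1 0) (eq (.prec f g) f 0 1))))
    (ex 1 (and (eq .left .left 1 0)
      (and (eq .right (.comp .succ .right) 0 1)
        (eq (.prec f g) (.comp g (stepArg f g)) 0 1)))))

/-- The projections at `0` vanish, and the projections at a successor are obtained by moving one
step along the enumeration `Nat.unpair` of pairs, which runs through the shells
`max a b = 0, 1, 2, …`. -/
def unpairAx : OrderFormula :=
  and (all 0 (or (lt .zero .id 0 0) (and (eq .left .zero 0 0) (eq .right .zero 0 0))))
    (all 0 (all 1 (or (lt .id .succ 1 0) (or (lt .succ .id 0 1)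
      (or (and (lt (.comp .succ .left) .right 0 0)
          (and (eq .left (.comp .succ .left) 1 0) (eq .right .right 1 0)))
      (or (and (eq (.comp .succ .left) .right 0 0)
          (and (eq .left .right 1 0) (eq .right .zero 1 1)))
      (or (and (lt .right .left 0 0)
          (and (eq .left .left 1 0) (eq .right (.comp .succ .right) 1 0)))
        (and (eq .left .right 0 0)
          (and (eq .left .zero 1 1) (eq .right (.comp .succ .left) 1 0))))))))))

/-- The axioms that force individuals to be natural numbers. -/
def arithAx : OrderFormula :=
  and zeroAx (and succAx (and (compAx .succ .left) (and (compAx .succ .right) unpairAx)))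

/-- The axioms that determine the function denoted by a code. -/
def codeAx : Code → OrderFormula
  | .pair f g => and (codeAx f) (and (codeAx g) (pairAx f g))
  | .comp f g => and (codeAx f) (and (codeAx g) (compAx f g))
  | .prec f g =>
    and (codeAx f) (and (codeAx g)
      (and (pairAx .right (.prec f g)) (and (pairAx .left (.pair .right (.prec f g)))
        (and (compAx g (stepArg f g)) (precAx f g)))))
  | .rfind' f => all 0 (eq (.rfind' f) .zero 0 0)
  | _ => le .zero .zero 0 0

end OrderFormula

theorem Nat.unpair_succ (n : ℕ) :
    (n.unpair.1 + 1 < n.unpair.2 ∧ (n + 1).unpair = (n.unpair.1 + 1, n.unpair.2)) ∨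
    (n.unpair.1 + 1 = n.unpair.2 ∧ (n + 1).unpair = (n.unpair.2, 0)) ∨
    (n.unpair.2 < n.unpair.1 ∧ (n + 1).unpair = (n.unpair.1, n.unpair.2 + 1)) ∨
    (n.unpair.1 = n.unpair.2 ∧ (n + 1).unpair = (0, n.unpair.1 + 1)) := by
  have key : ∀ a b : ℕ, Nat.pair n.unpair.1 n.unpair.2 + 1 = Nat.pair a b →
      (n + 1).unpair = (a, b) := by
    intro a b h
    rw [Nat.pair_unpair] at h
    rw [h, Nat.unpair_pair]
  generalize n.unpair.1 = a at *
  generalize n.unpair.2 = b at *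
  rcases lt_trichotomy (a + 1) b with h | h | h
  · refine .inl ⟨h, key _ _ ?_⟩
    rw [Nat.pair, Nat.pair, if_pos h, if_pos (by omega)]; ring
  · refine .inr (.inl ⟨h, key _ _ ?_⟩)
    rw [Nat.pair, Nat.pair, if_pos (by omega), if_neg (by omega), ← h]; ring
  · rcases lt_or_eq_of_le (Nat.lt_succ_iff.1 h) with h | rfl
    · refine .inr (.inr (.inl ⟨h, key _ _ ?_⟩))
      rw [Nat.pair, Nat.pair, if_neg (by omega), if_neg (by omega)]; ring
    · refine .inr (.inr (.inr ⟨rfl, key _ _ ?_⟩))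
      rw [Nat.pair, Nat.pair, if_neg (by omega), if_pos (by omega)]; ring

/-! ### Truth of the axioms in the standard model -/

section StandardModel

variable {h : ℕ → ℕ}

theorem sat_compAx (f g : Code) : Sat Set.univ Code.value h (compAx f g) := by
  simp [compAx, Sat, Code.value_id, Code.value]

theorem sat_pairAx (f g : Code) : Sat Set.univ Code.value h (pairAx f g) := by
  simp [pairAx, Sat, Code.value_id, Code.value]

theorem sat_precAx (f g : Code) : Sat Set.univ Code.value h (precAx f g) := by
  simp only [precAx, stepArg, Sat, Code.value_id, Code.value, sat_eq, Set.mem_univ, true_and,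
    forall_const]
  intro n
  rcases hr : n.unpair.2 with _ | r
  · left
    simp [hr]
  · right
    exact ⟨Nat.pair n.unpair.1 r, by simp [hr]⟩

theorem sat_arithAx : Sat Set.univ Code.value h arithAx := by
  refine ⟨?_, ?_, sat_compAx _ _, sat_compAx _ _, ?_, ?_⟩
  · simp [zeroAx, Sat, Code.value, Code.value_id]
  · simp [succAx, Sat, Code.value, Code.value_id]
    omega
  · simp only [Sat, Code.value, Code.value_id, sat_eq]
    intro n _
    rcases Nat.eq_zero_or_pos n with rfl | hn
    · right; simp
    · left; simpa using hn
  · simp only [Sat, Code.value, Code.value_id, sat_eq]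
    intro n _ m _
    have := Nat.unpair_succ n
    rcases lt_trichotomy m (n + 1) with hm | rfl | hm
    · exact .inl (by simpa using hm)
    · simpa only [Fin.val_zero, Fin.val_one, Function.update_self, Function.update_of_ne,
        ne_eq, zero_ne_one, not_false_eq_true, lt_irrefl, false_or, Prod.ext_iff] using this
    · exact .inr (.inl (by simpa using hm))

theorem sat_codeAx (c : Code) : Sat Set.univ Code.value h (codeAx c) := by
  induction c with
  | zero | succ | left | right => exact le_rfl
  | pair f g h₁ h₂ => exact ⟨h₁, h₂, sat_pairAx f g⟩
  | comp f g h₁ h₂ => exact ⟨h₁, h₂, sat_compAx f g⟩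
  | prec f g h₁ h₂ =>
    exact ⟨h₁, h₂, sat_pairAx _ _, sat_pairAx _ _, sat_compAx _ _, sat_precAx f g⟩
  | rfind' f => simp [codeAx, Sat, Code.value]

end StandardModel

/-! ### Every model of the axioms is standard -/

/-- The functions `V` on `D` are an arithmetic: individuals are numbered by `num`, onto `ℕ`, the
number `n` has the value `e n`, and the basic functions have their usual values. -/
structure IsArithmetic {U : Type*} (D : Set U) (V : Code → U → ℕ∞) (e : ℕ → ℕ∞) (num : U → ℕ) :
    Prop where
  strictMono : StrictMono e
  exists_num (n : ℕ) : ∃ a ∈ D, num a = n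
  zero : ∀ a ∈ D, V .zero a = e 0
  id : ∀ a ∈ D, V .id a = e (num a)
  succ : ∀ a ∈ D, V .succ a = e (num a + 1)
  left : ∀ a ∈ D, V .left a = e (num a).unpair.1
  right : ∀ a ∈ D, V .right a = e (num a).unpair.2

namespace IsArithmetic

variable {U : Type*} {D : Set U} {V : Code → U → ℕ∞} {e : ℕ → ℕ∞} {num : U → ℕ} {h : ℕ → U}
  {f g : Code}

theorem comp_apply (H : IsArithmetic D V e num) (hs : Sat D V h (compAx f g))
    {a : U} (ha : a ∈ D) {m k : ℕ} (hg : V g a = e m)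
    (hf : ∀ b ∈ D, num b = m → V f b = e k) : V (.comp f g) a = e k := by
  simp [compAx, Sat] at hs
  obtain ⟨b, hb, h₁, h₂⟩ := hs a ha
  rw [h₂]
  rw [H.id b hb, hg] at h₁
  exact hf b hb (H.strictMono.injective h₁)

theorem pair_apply (H : IsArithmetic D V e num) (hs : Sat D V h (pairAx f g))
    {a : U} (ha : a ∈ D) {m k : ℕ} (hf : V f a = e m) (hg : V g a = e k) :
    V (.pair f g) a = e (Nat.pair m k) := by
  simp [pairAx, Sat] at hs
  obtain ⟨b, hb, h₁, h₂, h₃⟩ := hs a ha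
  rw [H.left b hb, hf] at h₂
  rw [H.right b hb, hg] at h₃
  rw [← h₁, H.id b hb, ← H.strictMono.injective h₂, ← H.strictMono.injective h₃, Nat.pair_unpair]

/-- By induction on the recursion variable, the recursion equations determine `prec f g`. -/
theorem prec_apply (H : IsArithmetic D V e num)
    (hf : ∀ a ∈ D, V f a = e (f.value (num a))) (hg : ∀ a ∈ D, V g a = e (g.value (num a)))
    (hsucc : Sat D V h (compAx .succ .right))
    (h₁ : Sat D V h (pairAx .right (.prec f g)))
    (h₂ : Sat D V h (pairAx .left (.pair .right (.prec f g))))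
    (h₃ : Sat D V h (compAx g (stepArg f g))) (h₄ : Sat D V h (precAx f g)) :
    ∀ a ∈ D, V (.prec f g) a = e (Code.value (.prec f g) (num a)) := by
  have key : ∀ r, ∀ a ∈ D, (num a).unpair.2 = r →
      V (.prec f g) a = e (Code.value (.prec f g) (num a)) := by
    intro r
    induction r using Nat.strong_induction_on with
    | _ r ih =>
      intro a ha hr
      simp [precAx, Sat] at h₄
      rcases h₄ a ha with ⟨h0, b, hb, hid, hp⟩ | ⟨b, hb, hl, hrt, hp⟩
      · rw [H.right a ha, H.zero a ha] at h0
        rw [H.id b hb, H.left a ha] at hid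
        rw [hp, hf b hb, H.strictMono.injective hid]
        simp [Code.value, H.strictMono.injective h0]
      · rw [H.left a ha, H.left b hb] at hl
        have hl := H.strictMono.injective hl
        have hs : V (.comp .succ .right) b = e ((num b).unpair.2 + 1) :=
          H.comp_apply hsucc hb (H.right b hb) fun c hc hn => hn ▸ H.succ c hc
        rw [hs, H.right a ha] at hrt
        have hrt := H.strictMono.injective hrt
        have hpb := ih (num b).unpair.2 (by omega) b hb rfl
        have harg := H.pair_apply h₂ hb (H.left b hb) (H.pair_apply h₁ hb (H.right b hb) hpb)
        rw [hp, H.comp_apply h₃ hb harg fun c hc hn => hn ▸ hg c hc]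
        simp only [Code.value]
        rw [hrt, ← hl]
  exact fun a ha => key _ a ha rfl

/-- Values lie in `ℕ∞`, so a finite value is exceeded by the value of some number; by the successor
axioms, a value of `id` below it is the value of a smaller number. -/
theorem of_sat (hs : Sat D V h arithAx) :
    ∃ e num, IsArithmetic D V e num := by
  obtain ⟨hzero, hsucc, hl, hr, hu⟩ := hs
  simp [zeroAx, Sat] at hzero
  simp [succAx, Sat] at hsucc
  simp [compAx, Sat] at hl hr
  simp [unpairAx, Sat] at hu
  obtain ⟨hz₁, ⟨z, hz, hz₂⟩, hz₃⟩ := hzero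
  obtain ⟨hs₁, hs₂, hs₃⟩ := hsucc
  choose! nx hnxD hnx using hs₃
  let s : ℕ → U := fun n => nx^[n] z
  have hsD : ∀ n, s n ∈ D := by
    intro n
    induction n with
    | zero => exact hz
    | succ n ih => rw [show s (n + 1) = nx (s n) from Function.iterate_succ_apply' nx n z]
                   exact hnxD _ ih
  obtain ⟨e, he⟩ : ∃ e : ℕ → ℕ∞, ∀ n, V .id (s n) = e n := ⟨_, fun _ => rfl⟩
  have hs_succ : ∀ n, V .succ (s n) = e (n + 1) := fun n => by
    rw [← he, show s (n + 1) = nx (s n) from Function.iterate_succ_apply' nx n z, hnx _ (hsD n)]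
  have hmono : StrictMono e := strictMono_nat_of_lt_succ fun n => by
    rw [← he n, ← hs_succ n]
    exact hs₁ _ (hsD n)
  have hzero : ∀ a ∈ D, V .zero a = e 0 := fun a ha => by
    rw [← he 0]
    exact (le_antisymm (hz₁ a ha z hz) (hz₁ z hz a ha)).trans hz₂.symm
  have hsucc : ∀ n, ∀ a ∈ D, V .id a = e n → V .succ a = e (n + 1) := by
    intro n a ha hn
    apply le_antisymm
    · rw [← he]
      refine (hs₂ a ha _ (hsD (n + 1))).resolve_left ?_
      rw [he, hn, not_le]
      exact hmono n.lt_succ_self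
    · rw [← hs_succ, ← hnx a ha]
      refine (hs₂ _ (hsD n) _ (hnxD a ha)).resolve_left ?_
      rw [he, ← hn, hnx a ha, not_le]
      exact hs₁ a ha
  have hnum : ∀ a ∈ D, ∃ n, V .id a = e n := by
    intro a ha
    have hfin : ∀ n, e n ≤ V .id a ∨ ∃ k, V .id a = e k := by
      intro n
      induction n with
      | zero => exact .inl (hzero a ha ▸ hz₃ a ha)
      | succ n ih =>
        rcases ih with hle | hk
        · rcases hle.eq_or_lt with heq | hlt
          · exact .inr ⟨n, heq.symm⟩
          · rw [← he] at hlt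
            rw [← hs_succ]
            exact .inl ((hs₂ _ (hsD n) a ha).resolve_left (not_le.2 hlt))
        · exact .inr hk
    have hle : ∀ n : ℕ, (n : ℕ∞) ≤ e n := by
      intro n
      induction n with
      | zero => exact zero_le
      | succ n ih =>
        push_cast
        exact Order.add_one_le_of_lt (ih.trans_lt (hmono n.lt_succ_self))
    -- the value of `id` at `a` is finite because that of `succ` is greater
    obtain ⟨N, hN⟩ := ENat.ne_top_iff_exists.1 (hs₁ a ha).ne_top
    refine (hfin (N + 1)).resolve_left (not_le.2 ?_)
    rw [← hN]
    exact (Nat.cast_lt.2 N.lt_succ_self).trans_le (hle _)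
  choose! num hnum using hnum
  have hsl : ∀ a ∈ D, ∀ k, V .left a = e k → V (.comp .succ .left) a = e (k + 1) := by
    intro a ha k hk
    obtain ⟨b, hb, h₁, h₂⟩ := hl a ha
    rw [h₂, hsucc k b hb (h₁.trans hk)]
  have hsr : ∀ a ∈ D, ∀ k, V .right a = e k → V (.comp .succ .right) a = e (k + 1) := by
    intro a ha k hk
    obtain ⟨b, hb, h₁, h₂⟩ := hr a ha
    rw [h₂, hsucc k b hb (h₁.trans hk)]
  have hproj : ∀ n, ∀ a ∈ D, V .id a = e n →
      V .left a = e n.unpair.1 ∧ V .right a = e n.unpair.2 := by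
    intro n
    induction n with
    | zero =>
      intro a ha hn
      have := (hu.1 a ha).resolve_left (by rw [hzero a ha, hn]; exact lt_irrefl _)
      simpa [hzero a ha] using this
    | succ n ih =>
      intro a ha hn
      obtain ⟨h₁, h₂⟩ := ih (s n) (hsD n) (he n)
      have hu := ((hu.2 (s n) (hsD n) a ha).resolve_left
        (by rw [hn, hs_succ]; exact lt_irrefl _)).resolve_left
        (by rw [hn, hs_succ]; exact lt_irrefl _)
      rw [hsl _ (hsD n) _ h₁, hsr _ (hsD n) _ h₂, h₁, h₂, hzero a ha] at hu
      simp only [hmono.lt_iff_lt, hmono.injective.eq_iff] at hu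
      have hun := Nat.unpair_succ n
      rcases hu with ⟨c, hu⟩ | ⟨c, hu⟩ | ⟨c, hu⟩ | ⟨c, hu⟩ <;>
      rcases hun with ⟨c', hun⟩ | ⟨c', hun⟩ | ⟨c', hun⟩ | ⟨c', hun⟩ <;>
      first
        | (exfalso; omega)
        | (rw [hun]; exact hu)
  refine ⟨e, num, hmono, fun n => ⟨s n, hsD n, ?_⟩, hzero, hnum, ?_, ?_, ?_⟩
  · exact hmono.injective ((hnum _ (hsD n)).symm.trans (he n))
  · exact fun a ha => hsucc _ a ha (hnum a ha)
  · exact fun a ha => (hproj _ a ha (hnum a ha)).1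
  · exact fun a ha => (hproj _ a ha (hnum a ha)).2

/-- In an arithmetic that satisfies its axioms, a code has the value that it denotes. -/
theorem value_eq (H : IsArithmetic D V e num) (hs : Sat D V h arithAx) {c : Code}
    (hc : Sat D V h (codeAx c)) : ∀ a ∈ D, V c a = e (c.value (num a)) := by
  induction c with
  | zero => exact H.zero
  | succ => exact H.succ
  | left => exact H.left
  | right => exact H.right
  | pair f g h₁ h₂ =>
    exact fun a ha => H.pair_apply hc.2.2 ha (h₁ hc.1 a ha) (h₂ hc.2.1 a ha)
  | comp f g h₁ h₂ =>
    exact fun a ha => H.comp_apply hc.2.2 ha (h₂ hc.2.1 a ha) fun b hb hn => by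
      rw [h₁ hc.1 b hb, hn, Code.value]
  | prec f g h₁ h₂ =>
    obtain ⟨hf, hg, k₁, k₂, k₃, k₄⟩ := hc
    exact H.prec_apply (h₁ hf) (h₂ hg) hs.2.2.2.1 k₁ k₂ k₃ k₄
  | rfind' f =>
    simp [codeAx, Sat] at hc
    intro a ha
    rw [hc a ha, H.zero a ha, Code.value]

end IsArithmetic

/-! ### The reductions -/

namespace OrderFormula

/-- The formula saying that the variable `0` is the number `n`. -/
def numeral : ℕ → OrderFormula
  | 0 => eq .id .zero 0 0
  | n + 1 => ex 1 (and (eq .id .succ 0 1) (ex 0 (and (eq .id .id 0 1) (numeral n))))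

/-- The function denoted by `c` has no zero of the form `Nat.pair x₀ m`. -/
def noZero (c : Code) : OrderFormula :=
  all 1 (or (lt .left .id 1 0) (or (lt .id .left 0 1) (lt .zero c 1 1)))

/-- The function denoted by `c` has a zero of the form `Nat.pair x₀ m`. -/
def someZero (c : Code) : OrderFormula :=
  ex 1 (and (eq .left .id 1 0) (eq c .zero 1 1))

/-- The conjunction of the axioms of arithmetic, those of the code `c`, and the statement that `χ`
holds of the number `n`. -/
def instanceAx (c : Code) (χ : OrderFormula) (n : ℕ) : OrderFormula :=
  and arithAx (and (codeAx c) (ex 0 (and (numeral n) χ)))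

/-- The formula whose refutation at a world amounts to a model of `instanceAx c χ n`. -/
def reduction (c : Code) (χ : OrderFormula) (n : ℕ) : IPFormula :=
  .imp (instanceAx c χ n).toIP falsum

theorem reduction_mem (c : Code) (χ : OrderFormula) (n : ℕ) :
    reduction c χ n ∈ IPFormula.twoVarFragment :=
  ⟨toIP_mem (instanceAx c χ n), falsum_mem⟩

theorem sat_numeral {n : ℕ} :
    ∀ {h : ℕ → ℕ}, h 0 = n → Sat Set.univ Code.value h (numeral n) := by
  induction n with
  | zero => intro h hh; simp [numeral, Code.value_id, Code.value, hh]
  | succ n ih =>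
    intro h hh
    refine ⟨n, trivial, ?_, n, trivial, ?_, ih rfl⟩ <;>
      simp [Code.value_id, Code.value, hh]

theorem sat_instanceAx {c : Code} {χ : OrderFormula} {n : ℕ} {h : ℕ → ℕ}
    (hχ : Sat Set.univ Code.value (Function.update h 0 n) χ) :
    Sat Set.univ Code.value h (instanceAx c χ n) :=
  ⟨sat_arithAx, sat_codeAx c, n, trivial, sat_numeral rfl, hχ⟩

end OrderFormula

namespace IsArithmetic

variable {U : Type*} {D : Set U} {V : Code → U → ℕ∞} {e : ℕ → ℕ∞} {num : U → ℕ} {h : ℕ → U}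
  {c : Code}

theorem num_eq_of_sat_numeral (H : IsArithmetic D V e num) {n : ℕ} :
    ∀ {h : ℕ → U}, h 0 ∈ D → Sat D V h (numeral n) → num (h 0) = n := by
  induction n with
  | zero =>
    intro h hh hn
    simp only [numeral, sat_eq, Fin.val_zero, H.id _ hh, H.zero _ hh] at hn
    exact H.strictMono.injective hn
  | succ n ih =>
    rintro h hh ⟨a, ha, h₁, b, hb, h₂, h₃⟩
    have hnum := ih (by simpa using hb) h₃
    simp [H.id _ hh, H.succ _ ha] at h₁
    simp [H.id _ ha, H.id _ hb] at h₂
    simp only [Function.update_self, Fin.val_zero] at hnum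
    rw [H.strictMono.injective h₁, ← H.strictMono.injective h₂, hnum]

theorem value_ne_zero (H : IsArithmetic D V e num)
    (hV : ∀ a ∈ D, V c a = e (c.value (num a))) (hh : h 0 ∈ D) (hs : Sat D V h (noZero c))
    {m : ℕ} (hm : m.unpair.1 = num (h 0)) : c.value m ≠ 0 := by
  obtain ⟨a, ha, rfl⟩ := H.exists_num m
  have := hs a ha
  simp [Sat, H.left a ha, H.id _ hh, H.zero a ha, hV a ha, hm] at this
  exact (H.strictMono.lt_iff_lt.1 this).ne'

theorem exists_value_eq_zero (H : IsArithmetic D V e num)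
    (hV : ∀ a ∈ D, V c a = e (c.value (num a))) (hh : h 0 ∈ D) (hs : Sat D V h (someZero c)) :
    ∃ m : ℕ, m.unpair.1 = num (h 0) ∧ c.value m = 0 := by
  obtain ⟨a, ha, h₁, h₂⟩ := hs
  simp [H.left a ha, H.id _ hh] at h₁
  simp [hV a ha, H.zero a ha] at h₂
  exact ⟨num a, H.strictMono.injective h₁, H.strictMono.injective h₂⟩

end IsArithmetic

theorem reduction_notMem_constLogic {c : Code} {χ : OrderFormula} {n : ℕ}
    (hχ : ∀ h : ℕ → ℕ, h 0 = n → Sat Set.univ Code.value h χ) :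
    reduction c χ n ∉ (constAugFrame ℕ ℕ).logic := by
  intro hmem
  have hV : ∀ a, Code.value .zero a = 0 := fun _ => rfl
  have := hmem (interpOfValues Code.value) 0 (fun _ => 0) (fun _ _ => trivial) 0 le_rfl
    (truth_toIP_of_sat hV (sat_instanceAx (hχ _ (by simp))))
  exact lt_irrefl 0 ((interpOfValues_truth_falsum hV).1 this)

/-- A refutation of the reduction at some world yields an arithmetic on the domain of a world
above it, so it suffices that `χ` fails of `n` in every arithmetic. -/
theorem reduction_mem_expLogic {c : Code} {χ : OrderFormula} {n : ℕ}
    (hχ : ∀ (U : Type u) (D : Set U) (V : Code → U → ℕ∞) (e : ℕ → ℕ∞) (num : U → ℕ) (h : ℕ → U),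
      IsArithmetic D V e num → (∀ a ∈ D, V c a = e (c.value (num a))) → h 0 ∈ D →
        num (h 0) = n → ¬ Sat D V h χ) :
    reduction c χ n ∈ expLogic.{u} ℕ := by
  intro U F I w g _ v _ hax
  by_contra hG
  -- the truth of the sentence `falsum` does not depend on the assignment
  have hG' : ∀ g, ¬ I.Truth v g falsum := fun g' ⟨a, ha, h⟩ => hG ⟨a, ha, by
    simpa [letter, KripkeInterp.Truth] using h⟩
  obtain ⟨harith, hc, a, ha, hn, hs⟩ := KripkeInterp.sat_of_truth_toIP hG' hax
  obtain ⟨e, num, H⟩ := IsArithmetic.of_sat harith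
  have h0 : Function.update g ((0 : Fin 2) : ℕ) a 0 ∈ F.dom v := by simpa using ha
  exact hχ U _ _ e num _ H (H.value_eq harith hc) h0 (H.num_eq_of_sat_numeral h0 hn) hs

theorem noZero_reduction_mem_iff {L : Set IPFormula} (hL : expLogic.{u} ℕ ⊆ L)
    (hL' : L ⊆ (constAugFrame ℕ ℕ).logic) (c : Code) (n : ℕ) :
    reduction c (noZero c) n ∈ L ↔ ∃ m : ℕ, m.unpair.1 = n ∧ c.value m = 0 := by
  constructor
  · intro hmem
    by_contra! hz
    refine reduction_notMem_constLogic (χ := noZero c) (fun h hh m _ => ?_) (hL' hmem)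
    simp only [Sat, Fin.val_zero, Fin.val_one, Function.update_self, Code.value_id, Code.value,
      Function.update_of_ne zero_ne_one, hh]
    have := hz m
    omega
  · rintro ⟨m, hm, hc⟩
    exact hL (reduction_mem_expLogic fun U D V e num h H hV h0 hn hs =>
      H.value_ne_zero hV h0 hs (hm.trans hn.symm) hc)

theorem someZero_reduction_mem_iff {L : Set IPFormula} (hL : expLogic.{u} ℕ ⊆ L)
    (hL' : L ⊆ (constAugFrame ℕ ℕ).logic) (c : Code) (n : ℕ) :
    reduction c (someZero c) n ∈ L ↔ ¬ ∃ m : ℕ, m.unpair.1 = n ∧ c.value m = 0 := by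
  constructor
  · rintro hmem ⟨m, hm, hc⟩
    refine reduction_notMem_constLogic (χ := someZero c) (fun h hh => ⟨m, trivial, ?_, ?_⟩) (hL' hmem) <;>
      simp [Code.value_id, Code.value, hh, hm, hc]
  · intro hz
    refine hL (reduction_mem_expLogic fun U D V e num h H hV h0 hn hs => hz ?_)
    rw [← hn]
    exact H.exists_value_eq_zero hV h0 hs

/-! ### Computability of the reductions -/

namespace IPFormula

theorem primrec_and : Primrec₂ and := by
  refine Primrec₂.encode_iff.1 ?_
  have h : Primrec₂ fun φ ψ : IPFormula =>
      6 * Nat.pair (Encodable.encode φ) (Encodable.encode ψ) + 2 :=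
    Primrec.nat_add.comp (Primrec.nat_mul.comp (Primrec.const 6)
      (Primrec₂.natPair.comp (Primrec.encode.comp Primrec.fst)
        (Primrec.encode.comp Primrec.snd))) (Primrec.const 2)
  exact h

theorem primrec_imp : Primrec₂ imp := by
  refine Primrec₂.encode_iff.1 ?_
  have h : Primrec₂ fun φ ψ : IPFormula =>
      6 * Nat.pair (Encodable.encode φ) (Encodable.encode ψ) + 4 :=
    Primrec.nat_add.comp (Primrec.nat_mul.comp (Primrec.const 6)
      (Primrec₂.natPair.comp (Primrec.encode.comp Primrec.fst)
        (Primrec.encode.comp Primrec.snd))) (Primrec.const 4)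
  exact h

theorem primrec_ex (x : ℕ) : Primrec (ex x) := by
  refine Primrec.encode_iff.1 ?_
  have h : Primrec fun φ : IPFormula => 6 * Nat.pair x (Encodable.encode φ) + 6 :=
    Primrec.nat_add.comp (Primrec.nat_mul.comp (Primrec.const 6)
      (Primrec₂.natPair.comp (Primrec.const x) Primrec.encode)) (Primrec.const 6)
  exact h

end IPFormula

theorem primrec_toIP_numeral : Primrec fun n => (numeral n).toIP := by
  have hstep : Primrec₂ fun (_ : ℕ) (φ : IPFormula) =>
      IPFormula.ex 1 (.and (eq .id .succ 0 1).toIP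
        (.ex 0 (.and (eq .id .id 0 1).toIP φ))) :=
    (IPFormula.primrec_ex 1).comp (IPFormula.primrec_and.comp (Primrec.const _)
      ((IPFormula.primrec_ex 0).comp (IPFormula.primrec_and.comp (Primrec.const _) Primrec.snd)))
  refine (Primrec.nat_rec₁ (numeral 0).toIP hstep).of_eq fun n => ?_
  induction n with
  | zero => rfl
  | succ n ih => exact congrArg _ (congrArg _ (congrArg _ (congrArg _ ih)))

theorem computable_reduction (c : Code) (χ : OrderFormula) : Computable (reduction c χ) :=
  Primrec.to_comp <| IPFormula.primrec_imp.comp (IPFormula.primrec_and.comp (Primrec.const _)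
    (IPFormula.primrec_and.comp (Primrec.const _) ((IPFormula.primrec_ex 0).comp
      (IPFormula.primrec_and.comp primrec_toIP_numeral (Primrec.const _))))) (Primrec.const _)

/-- Kleene's normal form: a recursively enumerable set is the projection of the zero set of a
primitive recursive function. -/
theorem REPred.exists_code_value {p : ℕ → Prop} (hp : REPred p) :
    ∃ c : Code, ∀ n, p n ↔ ∃ m : ℕ, m.unpair.1 = n ∧ c.value m = 0 := by
  obtain ⟨d, hd⟩ := Code.exists_code.1 (Partrec.nat_iff.1
    ((show Partrec fun n => Part.assert (p n) fun _ => Part.some () from hp).map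
      (Computable.const 0).to₂))
  have hf : Primrec fun m : ℕ =>
      bif (Code.evaln m.unpair.2 d m.unpair.1).isSome then 0 else 1 :=
    Primrec.cond (Primrec.option_isSome.comp (Code.primrec_evaln.comp
      (((Primrec.snd.comp Primrec.unpair).pair (Primrec.const d)).pair
        (Primrec.fst.comp Primrec.unpair)))) (Primrec.const 0) (Primrec.const 1)
  obtain ⟨c, hc⟩ := (Primrec.nat_iff.1 hf).exists_code_value
  refine ⟨c, fun n => ?_⟩
  have hdom : p n ↔ ∃ x, x ∈ d.eval n := by simp [hd]
  simp only [hdom, Code.evaln_complete, hc]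
  constructor
  · rintro ⟨x, k, hx⟩
    exact ⟨Nat.pair n k, by simp, by simp [Option.mem_def.1 hx]⟩
  · rintro ⟨m, rfl, hm⟩
    cases hx : Code.evaln m.unpair.2 d m.unpair.1 with
    | none => simp [hx] at hm
    | some x => exact ⟨x, _, hx⟩

/-! ### Hardness -/

theorem sigmaOneHardIn_of_between {L : Set IPFormula} (hL : expLogic.{u} ℕ ⊆ L)
    (hL' : L ⊆ (constAugFrame ℕ ℕ).logic) : SigmaOneHardIn IPFormula.twoVarFragment L := by
  intro p hp
  obtain ⟨c, hc⟩ := hp.exists_code_value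
  exact ⟨reduction c (noZero c), computable_reduction _ _, reduction_mem _ _,
    fun n => (hc n).trans (noZero_reduction_mem_iff hL hL' c n).symm⟩

theorem piOneHardIn_of_between {L : Set IPFormula} (hL : expLogic.{u} ℕ ⊆ L)
    (hL' : L ⊆ (constAugFrame ℕ ℕ).logic) : PiOneHardIn IPFormula.twoVarFragment L := by
  intro p hp
  obtain ⟨c, hc⟩ := hp.exists_code_value
  exact ⟨reduction c (someZero c), computable_reduction _ _, reduction_mem _ _,
    fun n => (not_iff_not.1 (by
      rw [hc n, someZero_reduction_mem_iff hL hL' c n, not_not]))⟩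

/-- The complement of the halting problem reduces to a `Π⁰₁`-hard set. -/
theorem PiOneHardIn.not_rePred {S L : Set IPFormula} (h : PiOneHardIn S L) :
    ¬ REPred fun φ : IPFormula => φ ∈ L ∧ φ ∈ S := by
  intro hre
  obtain ⟨f, hf, hS, hfL⟩ := h
    (fun n => ¬ ((Denumerable.ofNat Code n).eval 0).Dom) (by
      simp only [not_not]
      exact (ComputablePred.halting_problem_re 0).comp (Computable.ofNat Code))
  refine ComputablePred.halting_problem_not_re 0 ?_
  refine REPred.of_eq (p := fun c : Code => f (Encodable.encode c) ∈ L ∧ f (Encodable.encode c) ∈ S)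
    (Partrec.comp hre (hf.comp Computable.encode)) fun c => ?_
  rw [and_iff_left (hS _), ← hfL, Denumerable.ofNat_encode]

/-- The interpretation on the universe lift of `ℕ` corresponding to one on `ℕ`. -/
def KripkeInterp.ulift (I : KripkeInterp (constAugFrame ℕ ℕ)) :
    KripkeInterp (constAugFrame ℕ (ULift.{u} ℕ)) where
  rel w k as := I.rel w k (as.map ULift.down)
  rel_dom _ _ _ _ _ _ := trivial
  heredity _ _ hw _ _ h := I.heredity hw _ _ h

theorem KripkeInterp.truth_ulift {I : KripkeInterp (constAugFrame ℕ ℕ)} {φ : IPFormula} :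
    ∀ {w : ℕ} {g : ℕ → ULift.{u} ℕ},
      I.ulift.Truth w g φ ↔ I.Truth w (fun x => (g x).down) φ := by
  induction φ with
  | bot => exact Iff.rfl
  | atom k xs => simp [Truth, ulift, Function.comp_def]
  | and φ ψ h₁ h₂ => exact and_congr h₁ h₂
  | or φ ψ h₁ h₂ => exact or_congr h₁ h₂
  | imp φ ψ h₁ h₂ => exact forall₂_congr fun _ _ => imp_congr h₁ h₂
  | all x φ ih =>
    have key : ∀ (g : ℕ → ULift.{u} ℕ) a, (fun y => (Function.update g x a y).down) =
        Function.update (fun y => (g y).down) x a.down := fun g a =>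
      (Function.comp_update ULift.down g x a)
    simp only [Truth, ih, key]
    intro w g
    exact ⟨fun h v hv a _ => h v hv ⟨a⟩ trivial, fun h v hv a _ => h v hv a.down trivial⟩
  | ex x φ ih =>
    have key : ∀ (g : ℕ → ULift.{u} ℕ) a, (fun y => (Function.update g x a y).down) =
        Function.update (fun y => (g y).down) x a.down := fun g a =>
      (Function.comp_update ULift.down g x a)
    simp only [Truth, ih, key]
    intro w g
    exact ⟨fun ⟨a, _, h⟩ => ⟨a.down, trivial, h⟩, fun ⟨a, _, h⟩ => ⟨⟨a⟩, trivial, h⟩⟩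

theorem expLogic_subset_constLogic : expLogic.{u} ℕ ⊆ (constAugFrame ℕ ℕ).logic :=
  fun _ h I w g _ => KripkeInterp.truth_ulift.1
    (h (ULift.{u} ℕ) _ I.ulift w (fun x => ⟨g x⟩) fun _ _ => trivial)

theorem theorem3 :
    (∀ L : Set IPFormula,
      expLogic.{u} ℕ ⊆ L → L ⊆ (constAugFrame ℕ ℕ).logic →
        SigmaOneHardIn IPFormula.twoVarFragment L ∧
        PiOneHardIn IPFormula.twoVarFragment L ∧
        ¬ REPred (fun φ : IPFormula => φ ∈ L ∧ φ ∈ IPFormula.twoVarFragment)) ∧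
    (SigmaOneHardIn IPFormula.twoVarFragment (expLogic.{u} ℕ) ∧
      PiOneHardIn IPFormula.twoVarFragment (expLogic.{u} ℕ) ∧
      ¬ REPred (fun φ : IPFormula =>
        φ ∈ expLogic.{u} ℕ ∧ φ ∈ IPFormula.twoVarFragment)) := by
  have main : ∀ L : Set IPFormula,
      expLogic.{u} ℕ ⊆ L → L ⊆ (constAugFrame ℕ ℕ).logic →
        SigmaOneHardIn IPFormula.twoVarFragment L ∧
        PiOneHardIn IPFormula.twoVarFragment L ∧
        ¬ REPred (fun φ : IPFormula => φ ∈ L ∧ φ ∈ IPFormula.twoVarFragment) :=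
    fun L hL hL' => ⟨sigmaOneHardIn_of_between hL hL', piOneHardIn_of_between hL hL',
      (piOneHardIn_of_between hL hL').not_rePred⟩
  exact ⟨main, main _ subset_rfl expLogic_subset_constLogic⟩
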